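/- Let $\Bbbk$ be an algebraically closed field and let $\mathcal{C}$ be a fusion category over $\Bbbk$: a $\Bbbk$-linear abelian rigid monoidal category with $\Bbbk$-bilinear tensor product and finite-dimensional Hom spaces, in which the unit $\mathbb{1}$ is simple, every object is a finite direct sum of simple objects, and there are finitely many simple objects up to isomorphism. Let $[\mathcal{C}]$ be its Grothendieck ring, with $[X]\cdot[Y]=[X\otimes Y]$. For an object $X$, let $\mathrm{FPdim}(X)$ be the Frobenius--Perron eigenvalue (the largest non-negative real eigenvalue) of the matrix $(r_{ij})$ defined by $[X]\cdot[S_i]=\sum_j r_{ij}[S_j]$, where $S_0,\dots,S_n$ represent the simple objects up to isomorphism. For a fusion quiver $Q$ over $\mathcal{C}$ (a finite quiver with vertex set $V$ whose edges $e$ are labelled by objects $\Pi_e$ of $\mathcal{C}$), set $\langle\alpha_v,\alpha_v\rangle_Q=2$ and, for $v\neq w$, $\langle\alpha_v,\alpha_w\rangle_Q=-\sum_{e:v\to w}[\Pi_e^{*}]-\sum_{e:w\to v}[\Pi_e]$, where $\Pi_e^*$ is the right dual. Let $\sigma^Q_v\in \mathrm{GL}_V([\mathcal{C}])$ be the right $[\mathcal{C}]$-linear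 reflection of $[\mathcal{C}]^V$ (acting by left multiplication on column vectors) with $\sigma^Q_v(\alpha_w)=\alpha_w-\alpha_v\langle\alpha_v,\alpha_w\rangle_Q$, and let $\mathbb{W}(Q)$ be the subgroup generated by the $\sigma^Q_v$, $v\in V$. Let $\Pi$ be an object of $\mathcal{C}$ with left dual ${}^*\Pi$ (so that there is an evaluation ${}^*\Pi\otimes\Pi\to\mathbb{1}$), let $Q$ be the fusion quiver with vertices $a,b$ and one edge $a\to b$ labelled $\Pi$, and let $Q'$ be the one with the same vertices and one edge $b\to a$ labelled ${}^*\Pi$. Put $$\sigma_a:=\sigma_a^{Q'}=\begin{pmatrix}-1&[{}^*\Pi]\\0&1\end{pmatrix},\qquad \sigma_b:=\sigma_b^{Q}=\begin{pmatrix}1&0\\ [\Pi]&-1\end{pmatrix}.$$ Then the operator $\sigma_a\sigma_b$ on $[\mathcal{C}]\oplus[\mathcal{C}]$ lies in $\mathbb{W}(Q)$. It has finite order if and only if $\mathrm{FPdim}(\Pi)<2$. Moreover, for every integer $m\ge 1$, its order is exactly $m$ if and only if $\mathrm{FPdim}(\Pi)=2\cos(\pi/m)$. -/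

import Mathlib

open CategoryTheory MonoidalCategory Limits

section

attribute [local instance] Abelian.hasFiniteBiproducts

/-- A fusion category over `k`: a `k`-linear abelian rigid monoidal category (with `k`-bilinear
tensor product) with finite-dimensional morphism spaces, such that the unit is simple, every object
is a finite direct sum of simple objects, and there are finitely many simple objects up to
isomorphism. -/
class FusionCategory (k : Type*) [Field k] (C : Type*) [Category C] [Abelian C] [Linear k C]
    [MonoidalCategory C] [MonoidalPreadditive C] [MonoidalLinear k C] [RigidCategory C] : Prop where
  simple_unit : Simple (𝟙_ C)
  finiteDimensional_hom : ∀ X Y : C, FiniteDimensional k (X ⟶ Y)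
  semisimple : ∀ X : C, ∃ (n : ℕ) (S : Fin n → C), (∀ i, Simple (S i)) ∧ Nonempty (X ≅ ⨁ S)
  finite_simples : ∃ (n : ℕ) (S : Fin n → C), ∀ X : C, Simple X → ∃ i, Nonempty (X ≅ S i)

end

namespace FusionCategory

section Duals

variable {C : Type*} [Category C] [MonoidalCategory C] [RigidCategory C]

/-- The left dual `L` of `X` in the convention of tensor category theory: it carries an evaluation
`L ⊗ X ⟶ 𝟙` and a coevaluation `𝟙 ⟶ X ⊗ L`. (Mathlib calls this object the right dual.) -/
abbrev lDual (X : C) : C := Xᘁ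

/-- The right dual `R` of `X` in the convention of tensor category theory: it carries an evaluation
`X ⊗ R ⟶ 𝟙` and a coevaluation `𝟙 ⟶ R ⊗ X`. (Mathlib calls this object the left dual.) -/
abbrev rDual (X : C) : C := ᘁX

end Duals

section Grothendieck

/-- The relations `[X₂] = [X₁] + [X₃]` for the short exact sequences `0 ⟶ X₁ ⟶ X₂ ⟶ X₃ ⟶ 0`. -/
def k0Relations (C : Type*) [Category C] [Abelian C] : AddSubgroup (FreeAbelianGroup C) :=
  AddSubgroup.closure {x | ∃ S : ShortComplex C, S.ShortExact ∧
    x = FreeAbelianGroup.of S.X₂ - FreeAbelianGroup.of S.X₁ - FreeAbelianGroup.of S.X₃}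

/-- The Grothendieck group `[C]` of an abelian category. -/
def K0 (C : Type*) [Category C] [Abelian C] : Type _ := FreeAbelianGroup C ⧸ k0Relations C

namespace K0

noncomputable instance (C : Type*) [Category C] [Abelian C] : AddCommGroup (K0 C) :=
  inferInstanceAs (AddCommGroup (FreeAbelianGroup C ⧸ k0Relations C))

variable {C : Type*} [Category C] [Abelian C]

/-- The class `[X]` of an object. -/
def of (X : C) : K0 C := QuotientAddGroup.mk (FreeAbelianGroup.of X)

theorem of_shortExact {S : ShortComplex C} (hS : S.ShortExact) : of S.X₂ = of S.X₁ + of S.X₃ := by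
  have h : (QuotientAddGroup.mk (FreeAbelianGroup.of S.X₂ - FreeAbelianGroup.of S.X₁
      - FreeAbelianGroup.of S.X₃) : FreeAbelianGroup C ⧸ k0Relations C) = 0 :=
    (QuotientAddGroup.eq_zero_iff _).2 (AddSubgroup.subset_closure ⟨S, hS, rfl⟩)
  have h' : of S.X₂ - of S.X₁ - of S.X₃ = 0 := h
  rwa [sub_sub, sub_eq_zero] at h'

/-- The universal property: an additive invariant of objects induces a map on `[C]`. -/
def lift {A : Type*} [AddCommGroup A] (f : C → A)
    (hf : ∀ S : ShortComplex C, S.ShortExact → f S.X₂ = f S.X₁ + f S.X₃) : K0 C →+ A :=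
  QuotientAddGroup.lift (k0Relations C) (FreeAbelianGroup.lift f) (by
    refine (AddSubgroup.closure_le _).2 ?_
    rintro _ ⟨S, hS, rfl⟩
    simp [hf S hS])

theorem lift_of {A : Type*} [AddCommGroup A] (f : C → A)
    (hf : ∀ S : ShortComplex C, S.ShortExact → f S.X₂ = f S.X₁ + f S.X₃) (X : C) :
    lift f hf (of X) = f X :=
  FreeAbelianGroup.lift_apply_of f X

theorem hom_ext {A : Type*} [AddCommGroup A] {f g : K0 C →+ A} (h : ∀ X : C, f (of X) = g (of X)) :
    f = g := by
  refine QuotientAddGroup.addMonoidHom_ext _ ?_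
  ext X
  exact h X

theorem of_iso {X Y : C} (e : X ≅ Y) : of X = of Y := by
  have h0 : ∀ Z : C, IsZero Z → of Z = 0 := fun Z hZ => by
    have hS : (ShortComplex.mk (0 : Z ⟶ Z) (0 : Z ⟶ Z) (by simp)).ShortExact :=
      { exact := ShortComplex.exact_of_isZero_X₂ _ hZ
        mono_f := hZ.mono _
        epi_g := hZ.epi _ }
    have := of_shortExact hS
    simpa using this
  obtain ⟨Z, hZ⟩ : ∃ Z : C, IsZero Z := HasZeroObject.zero
  have hS : (ShortComplex.mk e.hom (0 : Y ⟶ Z) (by simp)).ShortExact :=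
    { exact := (ShortComplex.exact_iff_epi _ rfl).2 (inferInstanceAs (Epi e.hom))
      mono_f := inferInstanceAs (Mono e.hom)
      epi_g := hZ.epi _ }
  have := of_shortExact hS
  rw [h0 _ hZ, add_zero] at this
  exact this.symm

theorem induction_on {p : K0 C → Prop} (x : K0 C) (of : ∀ X : C, p (of X))
    (neg : ∀ x, p x → p (-x)) (add : ∀ x y, p x → p y → p (x + y)) (zero : p 0) : p x := by
  obtain ⟨x, rfl⟩ := QuotientAddGroup.mk_surjective x
  induction x using FreeAbelianGroup.induction_on with
  | zero => exact zero
  | of X => exact of X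
  | neg X h => exact neg _ h
  | add x y hx hy => exact add _ _ hx hy

variable [MonoidalCategory C] [MonoidalPreadditive C] [RigidCategory C]

theorem shortExact_tensorLeft (X : C) {S : ShortComplex C} (hS : S.ShortExact) :
    (S.map (tensorLeft X)).ShortExact := by
  have : PreservesLimitsOfSize.{0, 0} (tensorLeft X) :=
    (tensorLeftAdjunction X Xᘁ).rightAdjoint_preservesLimits
  have : PreservesColimitsOfSize.{0, 0} (tensorLeft X) :=
    (tensorLeftAdjunction (ᘁX) X).leftAdjoint_preservesColimits
  exact hS.map_of_exact _

theorem shortExact_tensorRight (X : C) {S : ShortComplex C} (hS : S.ShortExact) :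
    (S.map (tensorRight X)).ShortExact := by
  have : PreservesColimitsOfSize.{0, 0} (tensorRight X) :=
    (tensorRightAdjunction X Xᘁ).leftAdjoint_preservesColimits
  have : PreservesLimitsOfSize.{0, 0} (tensorRight X) :=
    (tensorRightAdjunction (ᘁX) X).rightAdjoint_preservesLimits
  exact hS.map_of_exact _

theorem of_tensorLeft (X : C) (S : ShortComplex C) (hS : S.ShortExact) :
    of (X ⊗ S.X₂) = of (X ⊗ S.X₁) + of (X ⊗ S.X₃) :=
  of_shortExact (shortExact_tensorLeft X hS)

theorem of_tensorRight (Y : C) (S : ShortComplex C) (hS : S.ShortExact) :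
    of (S.X₂ ⊗ Y) = of (S.X₁ ⊗ Y) + of (S.X₃ ⊗ Y) :=
  of_shortExact (shortExact_tensorRight Y hS)

/-- The product on `[C]` as a biadditive map, determined by `[X] ↦ [Y] ↦ [X ⊗ Y]`. -/
noncomputable def mulHom : K0 C →+ K0 C →+ K0 C :=
  lift (fun X => lift (fun Y => of (X ⊗ Y)) (of_tensorLeft X))
    (fun S hS => hom_ext fun Y => by
      rw [AddMonoidHom.add_apply, lift_of, lift_of, lift_of]
      exact of_tensorRight Y S hS)

noncomputable instance : Mul (K0 C) := ⟨fun x y => mulHom x y⟩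

noncomputable instance : One (K0 C) := ⟨of (𝟙_ C)⟩

theorem mul_def (x y : K0 C) : x * y = mulHom x y := rfl

theorem of_mul_of (X Y : C) : of X * of Y = of (X ⊗ Y) := by
  rw [mul_def, mulHom, lift_of, lift_of]

theorem mul_assoc_aux (x y z : K0 C) : x * y * z = x * (y * z) := by
  induction x using induction_on with
  | of X =>
    induction y using induction_on with
    | of Y =>
      induction z using induction_on with
      | of Z =>
        simp only [of_mul_of]
        exact of_iso (α_ X Y Z)
      | neg z h => simp_all [mul_def]
      | add z w hz hw => simp_all [mul_def]
      | zero => simp [mul_def]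
    | neg y h => simp_all [mul_def]
    | add y w hy hw => simp_all [mul_def]
    | zero => simp [mul_def]
  | neg x h => simp_all [mul_def]
  | add x w hx hw => simp_all [mul_def]
  | zero => simp [mul_def]

/-- The Grothendieck ring `[C]`, with `[X] * [Y] = [X ⊗ Y]` and `1 = [𝟙]`. -/
noncomputable instance : Ring (K0 C) :=
  { (inferInstance : AddCommGroup (K0 C)), (inferInstance : Mul (K0 C)),
    (inferInstance : One (K0 C)) with
    left_distrib := fun x y z => by simp [mul_def]
    right_distrib := fun x y z => by simp [mul_def]
    zero_mul := fun x => by simp [mul_def]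
    mul_zero := fun x => by simp [mul_def]
    mul_assoc := mul_assoc_aux
    one_mul := fun x => by
      have h : mulHom (of (𝟙_ C)) = AddMonoidHom.id (K0 C) :=
        hom_ext fun X => by
          rw [← mul_def, of_mul_of]
          exact of_iso (λ_ X)
      exact DFunLike.congr_fun h x
    mul_one := fun x => by
      have h : mulHom.flip (of (𝟙_ C)) = AddMonoidHom.id (K0 C) :=
        hom_ext fun X => by
          rw [AddMonoidHom.flip_apply, ← mul_def, of_mul_of]
          exact of_iso (ρ_ X)
      exact DFunLike.congr_fun h x }

end K0

end Grothendieck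

section FPdim

/-- The set `Irr(C)` of isomorphism classes of simple objects. -/
def Irr (C : Type*) [Category C] [HasZeroMorphisms C] : Type _ :=
  Quotient ((isIsomorphicSetoid C).comap (Subtype.val : {X : C // Simple X} → C))

/-- A chosen representative of a class in `Irr(C)`. -/
noncomputable def Irr.rep {C : Type*} [Category C] [HasZeroMorphisms C] (i : Irr C) : C :=
  (Quotient.out i).1

variable (k : Type*) [Field k] {C : Type*} [Category C] [Abelian C] [Linear k C]
  [MonoidalCategory C] [MonoidalPreadditive C] [MonoidalLinear k C] [RigidCategory C]

theorem finite_irr [FusionCategory k C] : Finite (Irr C) := by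
  obtain ⟨n, S, hS⟩ := FusionCategory.finite_simples (k := k) (C := C)
  choose f hf using fun i : Irr C => hS i.rep (Quotient.out i).2
  refine Finite.of_injective f fun i j hij => ?_
  obtain ⟨e⟩ := hf i
  obtain ⟨e'⟩ := hf j
  rw [← hij] at e'
  rw [← Quotient.out_eq i, ← Quotient.out_eq j]
  exact Quotient.sound ⟨e ≪≫ e'.symm⟩

/-- The matrix of tensoring on the left with `X` in the basis of simple objects: its `(i, j)` entry
is the multiplicity of `S_j` in `X ⊗ S_i`. Over an algebraically closed field this multiplicity is
`dim_k Hom(X ⊗ S_i, S_j)`, since `End(S_j) = k`. -/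
noncomputable def fusionMatrix (X : C) : Matrix (Irr C) (Irr C) ℝ :=
  Matrix.of fun i j => (Module.finrank k (X ⊗ i.rep ⟶ j.rep) : ℝ)

/-- The Frobenius-Perron dimension of `X`: the Frobenius-Perron eigenvalue, i.e. the largest
non-negative real eigenvalue, of the non-negative matrix of tensoring with `X`. -/
noncomputable def FPdim [FusionCategory k C] (X : C) : ℝ :=
  letI : Fintype (Irr C) := @Fintype.ofFinite _ (finite_irr k)
  sSup {r : ℝ | 0 ≤ r ∧ Module.End.HasEigenvalue (Matrix.mulVecLin (fusionMatrix k X)) r}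

end FPdim

end FusionCategory

open FusionCategory

/-- A fusion quiver over `C` with vertex set `V` and edge set `E`: a quiver whose edges are
labelled by objects of `C`. -/
structure FusionQuiver (C : Type*) (V E : Type*) where
  src : E → V
  tgt : E → V
  label : E → C

namespace FusionQuiver

section Reflections

variable {C : Type*} [Category C] [Abelian C] [MonoidalCategory C] [MonoidalPreadditive C]
  [RigidCategory C] {V E : Type*} [Fintype V] [DecidableEq V] [Fintype E]

/-- The values `⟨α_v, α_w⟩_Q ∈ [C]` of the form of `Q` on basis vectors: `2` if `v = w`; otherwise
an edge `e : v → w` contributes `-[Π_e^*]` (right dual) and an edge `e : w → v` contributes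
`-[Π_e]`. -/
noncomputable def form (Q : FusionQuiver C V E) (v w : V) : K0 C :=
  if v = w then 2
  else ∑ e : E, ((if Q.src e = v ∧ Q.tgt e = w then -K0.of (rDual (Q.label e)) else 0) +
    (if Q.src e = w ∧ Q.tgt e = v then -K0.of (Q.label e) else 0))

/-- The matrix with row `v` equal to `(⟨α_v, α_w⟩_Q)_w` and all other rows zero. -/
noncomputable def formRow (Q : FusionQuiver C V E) (v : V) : Matrix V V (K0 C) :=
  Matrix.of fun u w => if u = v then Q.form v w else 0

theorem formRow_mul_self (Q : FusionQuiver C V E) (v : V) :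
    Q.formRow v * Q.formRow v = 2 * Q.formRow v := by
  ext u w
  rw [two_mul]
  have h2 : Q.form v v = 2 := by simp [form]
  by_cases h : u = v
  · simp [Matrix.mul_apply, formRow, h, h2, two_mul]
  · simp [Matrix.mul_apply, formRow, h]

theorem one_sub_formRow_mul_self (Q : FusionQuiver C V E) (v : V) :
    (1 - Q.formRow v) * (1 - Q.formRow v) = 1 := by
  have := Q.formRow_mul_self v
  rw [two_mul] at this
  rw [mul_sub, sub_mul, sub_mul, this]
  simp

/-- The reflection `σ_v`, as an invertible matrix over `[C]` acting by left multiplication on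
column vectors in `[C]^V`; it sends `m` to `m - ⟨α_v, m⟩_Q α_v`. -/
noncomputable def reflection (Q : FusionQuiver C V E) (v : V) :
    Matrix.GeneralLinearGroup V (K0 C) where
  val := 1 - Q.formRow v
  inv := 1 - Q.formRow v
  val_inv := Q.one_sub_formRow_mul_self v
  inv_val := Q.one_sub_formRow_mul_self v

theorem reflection_mulVec (Q : FusionQuiver C V E) (v : V) (m : V → K0 C) :
    (Q.reflection v).val.mulVec m = m - Pi.single v (∑ w, Q.form v w * m w) := by
  have h0 : (Q.reflection v).val = 1 - Q.formRow v := rfl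
  rw [h0, Matrix.sub_mulVec, Matrix.one_mulVec]
  congr 1
  ext u
  by_cases h : u = v
  · subst h
    simp [formRow, Matrix.mulVec, dotProduct]
  · simp [formRow, Matrix.mulVec, dotProduct, h]

/-- The reflection group `𝕎(Q)`. -/
noncomputable def reflectionGroup (Q : FusionQuiver C V E) :
    Subgroup (Matrix.GeneralLinearGroup V (K0 C)) :=
  Subgroup.closure (Set.range Q.reflection)

end Reflections

/-- The fusion quiver with vertices `a = 0` and `b = 1` and one edge `a → b` labelled `P`. -/
def rankTwo {C : Type*} (P : C) : FusionQuiver C (Fin 2) Unit where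
  src _ := 0
  tgt _ := 1
  label _ := P

/-- The fusion quiver with vertices `a = 0` and `b = 1` and one edge `b → a` labelled by the left
dual of `P`. -/
def rankTwoDual {C : Type*} [Category C] [MonoidalCategory C] [RigidCategory C] (P : C) :
    FusionQuiver C (Fin 2) Unit where
  src _ := 1
  tgt _ := 0
  label _ := lDual P

section RankTwo

variable {C : Type*} [Category C] [Abelian C] [MonoidalCategory C] [MonoidalPreadditive C]
  [RigidCategory C]

/-- The reflection `σ_a` on `[C] ⊕ [C]`, with matrix `(-1, [*P]; 0, 1)` in the basis `α_a, α_b`. -/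
noncomputable def sigmaA (P : C) : Matrix.GeneralLinearGroup (Fin 2) (K0 C) :=
  (rankTwoDual P).reflection 0

/-- The reflection `σ_b` on `[C] ⊕ [C]`, with matrix `(1, 0; [P], -1)` in the basis `α_a, α_b`. -/
noncomputable def sigmaB (P : C) : Matrix.GeneralLinearGroup (Fin 2) (K0 C) :=
  (rankTwo P).reflection 1

theorem sigmaA_val (P : C) : (sigmaA P).val = !![-1, K0.of (lDual P); 0, 1] := by
  have h0 : (sigmaA P).val = 1 - (rankTwoDual P).formRow 0 := rfl
  rw [h0]
  ext i j
  fin_cases i <;> fin_cases j <;> simp [formRow, form, rankTwoDual]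
  norm_num

theorem sigmaB_val (P : C) : (sigmaB P).val = !![1, 0; K0.of P, -1] := by
  have h0 : (sigmaB P).val = 1 - (rankTwo P).formRow 1 := rfl
  rw [h0]
  ext i j
  fin_cases i <;> fin_cases j <;> simp [formRow, form, rankTwo]
  norm_num

end RankTwo

end FusionQuiver

/-! The problem becomes one about the Grothendieck ring with its basis of simple classes. Put x =
[Π] and y = [*Π]. Multiplication by y is the transpose of multiplication by x (`K0.repr_lDual_mul`),
and a positive ring homomorphism d from [C] to the reals computes FPdim (`exists_character`,
`FPdim_eq_character`), with d(x) = d(y).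

The first column of (σ_a σ_b)^k consists of the terms c_{2k+1}, c_{2k} of the alternating Chebyshev
sequence `chebAlt` (`rankTwo_pow_fst`). If d(x) ≥ 2, the numbers d(c_n) increase strictly and no
positive power is the identity.

If d(x) = 2 cos θ < 2, then d(c_n) = sin(nθ)/sin θ. The decisive point is that this dimension cannot
cross zero without vanishing. Each pair of consecutive terms is a root, of value 1, of an integral
quadratic form on [C] ⊕ [C] (`dotForm_chebAlt`). A Schur test with d as weight makes the form
positive definite, so its roots are entirely non-negative or entirely non-positive. At the first n
with sin(nθ) ≤ 0, the class c_n is therefore non-negative of non-positive dimension, hence zero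
(`chebAlt_eq_zero`). This forces θ = π/n, and c_n = 0 makes the n-th power the identity. Applying d
to the first column shows that no smaller positive power works.

Membership in 𝕎(Q) needs [*Π] = [Π*], which holds because multiplication by either dual is the same
transpose. -/

namespace CategoryTheory

/-! ### Dimensions of Hom spaces -/

section BiproductHom

variable (k : Type*) [Field k] {C : Type*} [Category C] [Preadditive C] [Linear k C]
  {n : ℕ} (S : Fin n → C) [HasBiproduct S] (T : C)

/-- Morphisms out of a finite biproduct, as a linear equivalence. -/
noncomputable def biproductHomEquiv : ((⨁ S) ⟶ T) ≃ₗ[k] (∀ i, S i ⟶ T) where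
  toFun g i := biproduct.ι S i ≫ g
  map_add' _ _ := by ext; simp
  map_smul' _ _ := by ext; simp
  invFun g := biproduct.desc g
  left_inv g := by ext; simp
  right_inv g := by ext; simp

/-- Morphisms into a finite biproduct, as a linear equivalence. -/
noncomputable def homBiproductEquiv : (T ⟶ ⨁ S) ≃ₗ[k] (∀ i, T ⟶ S i) where
  toFun g i := g ≫ biproduct.π S i
  map_add' _ _ := by ext; simp
  map_smul' _ _ := by ext; simp
  invFun g := biproduct.lift g
  left_inv g := by ext; simp
  right_inv g := by ext; simp

end BiproductHom

section HomIso

variable (k : Type*) [Field k] {C : Type*} [Category C] [Preadditive C] [Linear k C]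

theorem finrank_hom_congr {X X' Y Y' : C} (e : X ≅ X') (e' : Y ≅ Y') :
    Module.finrank k (X ⟶ Y) = Module.finrank k (X' ⟶ Y') :=
  (Linear.homCongr k e e').finrank_eq

theorem Adjunction.finrank_hom_eq {D : Type*} [Category D] [Preadditive D] [Linear k D]
    {F : C ⥤ D} {G : D ⥤ C} (adj : F ⊣ G) [G.Additive] [G.Linear k] (X : C) (Y : D) :
    Module.finrank k (F.obj X ⟶ Y) = Module.finrank k (X ⟶ G.obj Y) := by
  refine LinearEquiv.finrank_eq
    { adj.homEquiv X Y with
      map_add' := fun f g => ?_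
      map_smul' := fun c f => ?_ }
  · simp [Adjunction.homEquiv_apply]
  · simp [Adjunction.homEquiv_apply, Functor.map_smul]

end HomIso

end CategoryTheory

/-! ### The Grothendieck ring of a fusion category: simple basis and duals -/

namespace FusionCategory

section

attribute [local instance] Abelian.hasFiniteBiproducts

theorem K0.of_isZero {C : Type*} [Category C] [Abelian C] {Z : C} (hZ : IsZero Z) :
    K0.of Z = 0 := by
  have hS : (ShortComplex.mk (0 : Z ⟶ Z) (0 : Z ⟶ Z) (by simp)).ShortExact :=
    { exact := ShortComplex.exact_of_isZero_X₂ _ hZ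
      mono_f := hZ.mono _
      epi_g := hZ.epi _ }
  simpa using K0.of_shortExact hS

theorem K0.of_biproduct {C : Type*} [Category C] [Abelian C] {n : ℕ} (S : Fin n → C) :
    K0.of (⨁ S) = ∑ i, K0.of (S i) := by
  induction n with
  | zero =>
    rw [Finset.univ_eq_empty, Finset.sum_empty]
    refine K0.of_isZero ((IsZero.iff_id_eq_zero _).2 ?_)
    ext i
    exact i.elim0
  | succ n ih =>
    have h0 : (biproduct.desc fun i : Fin n => biproduct.ι S i.succ) ≫ biproduct.π S 0 = 0 := by
      ext i
      simp [biproduct.ι_π_ne S (Fin.succ_ne_zero i)]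
    let sp : (ShortComplex.mk (biproduct.desc fun i : Fin n => biproduct.ι S i.succ)
        (biproduct.π S 0) h0).Splitting :=
      { r := biproduct.lift fun i : Fin n => biproduct.π S i.succ
        s := biproduct.ι S 0
        f_r := by
          ext i j
          by_cases h : i = j
          · subst h
            simp
          · have h' : j.succ ≠ i.succ := fun h' => h (Fin.succ_injective _ h').symm
            simp [biproduct.ι_π_ne S h', biproduct.ι_π_ne (fun i : Fin n => S i.succ) (Ne.symm h)]
        s_g := by simp
        id := by
          simp only
          rw [← biproduct.total (f := S), Fin.sum_univ_succ, biproduct.lift_desc]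
          exact add_comm _ _ }
    have := K0.of_shortExact sp.shortExact
    simp only at this
    rw [this, ih, Fin.sum_univ_succ, add_comm]

end

section Irr

variable {C : Type*} [Category C] [Abelian C]

instance simple_rep (i : Irr C) : Simple i.rep := (Quotient.out i).2

theorem Irr.exists_iso (X : C) [hX : Simple X] : ∃ i : Irr C, Nonempty (X ≅ i.rep) := by
  refine ⟨Quotient.mk _ ⟨X, hX⟩, ?_⟩
  obtain ⟨e⟩ := Quotient.exact (Quotient.out_eq (Quotient.mk
    ((isIsomorphicSetoid C).comap (Subtype.val : {X : C // Simple X} → C)) ⟨X, hX⟩))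
  exact ⟨e.symm⟩

theorem Irr.eq_of_iso {i j : Irr C} (e : i.rep ≅ j.rep) : i = j := by
  rw [← Quotient.out_eq i, ← Quotient.out_eq j]
  exact Quotient.sound ⟨e⟩

end Irr

section Semisimple

attribute [local instance] Abelian.hasFiniteBiproducts

variable (k : Type*) [Field k] {C : Type*} [Category C] [Abelian C] [Linear k C]
  [MonoidalCategory C] [MonoidalPreadditive C] [MonoidalLinear k C] [RigidCategory C]

/-- Some simple summand of E must map nontrivially to T; by Schur's lemma that component is an
isomorphism, and its inverse gives the section. -/
theorem exists_section_of_epi_simple [FusionCategory k C] {E T : C} [Simple T] (p : E ⟶ T) [Epi p] :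
    ∃ s : T ⟶ E, s ≫ p = 𝟙 T := by
  obtain ⟨n, S, hS, ⟨e⟩⟩ := FusionCategory.semisimple (k := k) E
  by_cases h : ∀ i, biproduct.ι S i ≫ e.inv ≫ p = 0
  · have h0 : e.inv ≫ p = 0 := by
      ext i
      simpa using h i
    have hp : p = 0 := by simpa using congrArg (e.hom ≫ ·) h0
    have : 𝟙 T = 0 := by
      rw [← cancel_epi p, hp]
      simp
    exact absurd this (id_nonzero T)
  · push Not at h
    obtain ⟨i, hi⟩ := h
    have := hS i
    have := isIso_of_hom_simple hi
    exact ⟨inv (biproduct.ι S i ≫ e.inv ≫ p) ≫ biproduct.ι S i ≫ e.inv, by simp⟩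

theorem projective_of_simple [FusionCategory k C] (T : C) [Simple T] : Projective T where
  factors {E X} f e _ := by
    -- The epimorphism pulled back along f lands on the simple T, so it splits.
    obtain ⟨s, hs⟩ := exists_section_of_epi_simple k (pullback.fst f e)
    refine ⟨s ≫ pullback.snd f e, ?_⟩
    rw [Category.assoc, ← pullback.condition, reassoc_of% hs]

variable [FusionCategory k C]

/-- Simple objects are projective, so Hom(T, -) is exact. This makes multiplicities well defined on
[C]. -/
theorem finrank_hom_shortExact (T : C) [Simple T] {S : ShortComplex C} (hS : S.ShortExact) :
    Module.finrank k (T ⟶ S.X₂) = Module.finrank k (T ⟶ S.X₁) + Module.finrank k (T ⟶ S.X₃) := by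
  have := FusionCategory.finiteDimensional_hom (k := k) T S.X₁
  have := FusionCategory.finiteDimensional_hom (k := k) T S.X₂
  have := projective_of_simple k T
  have := hS.mono_f
  have := hS.epi_g
  have h := LinearMap.finrank_range_add_finrank_ker (Linear.rightComp k T S.g)
  have hg : (Linear.rightComp k T S.g).range = ⊤ := LinearMap.range_eq_top.2 fun f =>
    ⟨Projective.factorThru f S.g, Projective.factorThru_comp f S.g⟩
  have hf : (Linear.rightComp k T S.g).ker = (Linear.rightComp k T S.f).range := by
    ext u
    rw [LinearMap.mem_ker]
    constructor
    · intro hu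
      exact ⟨hS.exact.lift u hu, hS.exact.lift_f u hu⟩
    · rintro ⟨v, rfl⟩
      simp
  have hinj : Function.Injective (Linear.rightComp k T S.f) := fun u v huv =>
    (cancel_mono S.f).1 huv
  rw [hg, hf, LinearMap.finrank_range_of_inj hinj, finrank_top] at h
  omega

/-- The coefficient of a class in `[C]` at a simple object. -/
noncomputable def K0.coeff (i : Irr C) : K0 C →+ ℤ :=
  K0.lift (fun X => (Module.finrank k (i.rep ⟶ X) : ℤ)) fun S hS => by
    exact_mod_cast finrank_hom_shortExact k i.rep hS

theorem K0.coeff_of (i : Irr C) (X : C) :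
    K0.coeff k i (K0.of X) = (Module.finrank k (i.rep ⟶ X) : ℤ) :=
  K0.lift_of _ _ X

variable [IsAlgClosed k]

open scoped Classical in
theorem K0.coeff_rep (i j : Irr C) : K0.coeff k i (K0.of j.rep) = if i = j then 1 else 0 := by
  have := FusionCategory.finiteDimensional_hom (k := k) (C := C)
  rw [K0.coeff_of, finrank_hom_simple_simple]
  have h : Nonempty (i.rep ≅ j.rep) ↔ i = j :=
    ⟨fun ⟨e⟩ => Irr.eq_of_iso e, fun h => ⟨eqToIso (by rw [h])⟩⟩
  simp only [h]
  split_ifs <;> rfl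

/-- In a fusion category, `dim Hom(X, T) = dim Hom(T, X)` for `T` simple. -/
theorem finrank_hom_comm (X T : C) [Simple T] :
    Module.finrank k (X ⟶ T) = Module.finrank k (T ⟶ X) := by
  classical
  have := FusionCategory.finiteDimensional_hom (k := k) (C := C)
  obtain ⟨n, S, hS, ⟨e⟩⟩ := FusionCategory.semisimple (k := k) X
  rw [finrank_hom_congr k e (Iso.refl T), finrank_hom_congr k (Iso.refl T) e,
    (biproductHomEquiv k S T).finrank_eq, (homBiproductEquiv k S T).finrank_eq,
    Module.finrank_pi_fintype, Module.finrank_pi_fintype]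
  refine Finset.sum_congr rfl fun i _ => ?_
  have := hS i
  rw [finrank_hom_simple_simple, finrank_hom_simple_simple]
  have h : Nonempty (S i ≅ T) ↔ Nonempty (T ≅ S i) :=
    ⟨fun ⟨e⟩ => ⟨e.symm⟩, fun ⟨e⟩ => ⟨e.symm⟩⟩
  exact if_congr h rfl rfl

variable [Fintype (Irr C)]

theorem K0.eq_sum_coeff (x : K0 C) : x = ∑ i, K0.coeff k i x • K0.of (Irr.rep i) := by
  classical
  induction x using K0.induction_on with
  | of X =>
    obtain ⟨n, S, hS, ⟨e⟩⟩ := FusionCategory.semisimple (k := k) X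
    rw [K0.of_iso e, K0.of_biproduct]
    simp only [map_sum, Finset.sum_smul]
    rw [Finset.sum_comm]
    refine Finset.sum_congr rfl fun l _ => ?_
    have := hS l
    obtain ⟨j, ⟨e'⟩⟩ := Irr.exists_iso (S l)
    rw [K0.of_iso e']
    simp [K0.coeff_rep]
  | neg x h =>
    conv_lhs => rw [h]
    simp
  | add x y hx hy =>
    conv_lhs => rw [hx, hy]
    simp [add_smul, Finset.sum_add_distrib]
  | zero => simp

/-- The classes of the simple objects form a basis of `[C]`. -/
noncomputable def K0.basis : Module.Basis (Irr C) ℤ (K0 C) := by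
  classical
  exact Module.Basis.ofEquivFun
    { toFun := fun x i => K0.coeff k i x
      map_add' := fun x y => by ext; simp
      map_smul' := fun c x => by ext; exact map_zsmul _ _ _
      invFun := fun c => ∑ i, c i • K0.of (Irr.rep i)
      left_inv := fun x => (K0.eq_sum_coeff k x).symm
      right_inv := fun c => by
        ext i
        simp only [map_sum, map_zsmul, K0.coeff_rep]
        simp }

theorem K0.basis_repr (x : K0 C) (i : Irr C) : (K0.basis k).repr x i = K0.coeff k i x := rfl

theorem K0.basis_apply (i : Irr C) : K0.basis k i = K0.of i.rep := by
  classical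
  refine (K0.basis k).repr.injective ?_
  ext j
  rw [Module.Basis.repr_self, K0.basis_repr, K0.coeff_rep, Finsupp.single_apply]
  simp only [eq_comm]

theorem fusionMatrix_apply (X : C) (i j : Irr C) :
    fusionMatrix k X i j = ((K0.basis k).repr (K0.of X * K0.basis k i) j : ℝ) := by
  rw [K0.basis_apply, K0.of_mul_of, K0.basis_repr, K0.coeff_of, fusionMatrix, Matrix.of_apply,
    finrank_hom_comm]
  simp

/-- Tensoring with the left dual is right adjoint to tensoring with X; semisimplicity allows the Hom
arguments to be swapped, so the two matrices are transposes. -/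
theorem K0.repr_lDual_mul (X : C) (i j : Irr C) :
    (K0.basis k).repr (K0.of (lDual X) * K0.basis k i) j =
      (K0.basis k).repr (K0.of X * K0.basis k j) i := by
  simp only [K0.basis_apply, K0.of_mul_of, K0.basis_repr, K0.coeff_of]
  rw [← finrank_hom_comm]
  exact_mod_cast (tensorLeftAdjunction X Xᘁ).finrank_hom_eq k i.rep j.rep

theorem K0.repr_rDual_mul (X : C) (i j : Irr C) :
    (K0.basis k).repr (K0.of (rDual X) * K0.basis k i) j =
      (K0.basis k).repr (K0.of X * K0.basis k j) i := by
  simp only [K0.basis_apply, K0.of_mul_of, K0.basis_repr, K0.coeff_of]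
  exact_mod_cast (((tensorLeftAdjunction (ᘁX) X).finrank_hom_eq k j.rep i.rep).symm.trans
    (finrank_hom_comm k (X ⊗ j.rep) i.rep))

include k in
-- The right dual gives the left adjoint instead, with the same transposed matrix. The two classes
-- then agree after multiplying 1.
theorem K0.of_lDual_eq_of_rDual (X : C) : K0.of (lDual X) = K0.of (rDual X) := by
  have h : (AddMonoidHom.mulLeft (K0.of (lDual X))).toIntLinearMap =
      (AddMonoidHom.mulLeft (K0.of (rDual X))).toIntLinearMap := by
    refine (K0.basis k).ext fun i => (K0.basis k).repr.injective ?_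
    ext j
    exact (K0.repr_lDual_mul k X i j).trans (K0.repr_rDual_mul k X i j).symm
  simpa using LinearMap.congr_fun h 1

end Semisimple

end FusionCategory

/-! ### Perron-Frobenius theory and the Schur test -/

section PerronFrobenius

variable {I : Type*} [Fintype I]

theorem Matrix.mulVec_pos_of_pos {A : Matrix I I ℝ} (hA : ∀ i j, 0 < A i j) {v : I → ℝ}
    (hv : 0 ≤ v) (hv0 : v ≠ 0) (i : I) : 0 < A.mulVec v i := by
  obtain ⟨j, hj⟩ := Function.ne_iff.1 hv0
  exact Finset.sum_pos' (fun l _ => mul_nonneg (hA i l).le (hv l))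
    ⟨j, Finset.mem_univ _, mul_pos (hA i j) ((hv j).lt_of_ne' hj)⟩

/-- The **Perron theorem**: a positive matrix has a positive eigenvector. -/
theorem Matrix.exists_pos_eigenvector [Nonempty I] {A : Matrix I I ℝ} (hA : ∀ i j, 0 < A i j) :
    ∃ (r : ℝ) (v : I → ℝ), (∀ i, 0 < v i) ∧ A.mulVec v = r • v := by
  classical
  set K : ℝ := ∑ i, ∑ j, A i j with hK
  -- Collatz-Wielandt: maximise r over the pairs with r v ≤ A v and v in the simplex. The entry sum
  -- K bounds r, so the set is compact.
  let s : Set (ℝ × (I → ℝ)) :=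
    (Set.Icc 0 K ×ˢ stdSimplex ℝ I) ∩ {p | ∀ i, p.1 * p.2 i ≤ A.mulVec p.2 i}
  have hs : IsCompact s := by
    refine (isCompact_Icc.prod (isCompact_stdSimplex ℝ I)).inter_right ?_
    simp only [Set.ofPred_forall]
    refine isClosed_iInter fun i => isClosed_le (by fun_prop) ?_
    exact (continuous_apply i).comp (continuous_const.matrix_mulVec continuous_snd)
  have hbound : ∀ (r : ℝ) (v : I → ℝ), v ∈ stdSimplex ℝ I → (∀ i, r * v i ≤ A.mulVec v i) →
      r ≤ K := by
    intro r v hv h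
    calc r = ∑ i, r * v i := by rw [← Finset.mul_sum, hv.2, mul_one]
      _ ≤ ∑ i, A.mulVec v i := Finset.sum_le_sum fun i _ => h i
      _ ≤ K := Finset.sum_le_sum fun i _ => Finset.sum_le_sum fun j _ =>
          mul_le_of_le_one_right (hA i j).le
            (hv.2 ▸ Finset.single_le_sum (fun l _ => hv.1 l) (Finset.mem_univ j))
  have hne : s.Nonempty := by
    obtain ⟨i⟩ := ‹Nonempty I›
    refine ⟨(0, Pi.single i 1), ⟨⟨le_rfl, ?_⟩, single_mem_stdSimplex ℝ i⟩, fun j => ?_⟩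
    · exact Finset.sum_nonneg fun i _ => Finset.sum_nonneg fun j _ => (hA i j).le
    · simpa using (hA j i).le
  obtain ⟨⟨r, v⟩, ⟨⟨hr, hv⟩, hrv⟩, hmax⟩ := hs.exists_isMaxOn hne continuous_fst.continuousOn
  simp only at hr hv hrv
  have hv0 : v ≠ 0 := by
    rintro rfl
    simpa using hv.2
  have hAv : ∀ i, 0 < A.mulVec v i := Matrix.mulVec_pos_of_pos hA hv.1 hv0
  have heig : A.mulVec v = r • v := by
    by_contra hcon
    have h1 : ∀ i, 0 < A.mulVec (A.mulVec v - r • v) i :=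
      Matrix.mulVec_pos_of_pos hA (fun i => sub_nonneg.2 (hrv i)) (sub_ne_zero.2 hcon)
    -- If A v ≠ r v, applying A once more makes every inequality strict, so w, normalised, admits a
    -- larger r.
    set w := A.mulVec v with hw
    have h2 : ∀ i, r * w i < A.mulVec w i := fun i => by
      have := h1 i
      rw [Matrix.mulVec_sub, Matrix.mulVec_smul] at this
      simpa using this
    obtain ⟨i0, hi0⟩ := Finite.exists_min fun i => A.mulVec w i / w i
    set r' := A.mulVec w i0 / w i0
    have hr' : r < r' := (lt_div_iff₀ (hAv i0)).2 (h2 i0)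
    have h3 : ∀ i, r' * w i ≤ A.mulVec w i := fun i => (le_div_iff₀ (hAv i)).1 (hi0 i)
    have hS : 0 < ∑ i, w i := Finset.sum_pos (fun i _ => hAv i) Finset.univ_nonempty
    set u : I → ℝ := (∑ i, w i)⁻¹ • w
    have hu : u ∈ stdSimplex ℝ I := by
      refine ⟨fun i => mul_nonneg (inv_nonneg.2 hS.le) (hAv i).le, ?_⟩
      simp only [u, Pi.smul_apply, smul_eq_mul]
      rw [← Finset.mul_sum, inv_mul_cancel₀ hS.ne']
    have hu' : ∀ i, r' * u i ≤ A.mulVec u i := fun i => by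
      simp only [u, Matrix.mulVec_smul, Pi.smul_apply, smul_eq_mul]
      rw [mul_left_comm]
      exact mul_le_mul_of_nonneg_left (h3 i) (inv_nonneg.2 hS.le)
    have hmem : (r', u) ∈ s := ⟨⟨⟨hr.1.trans hr'.le, hbound r' u hu hu'⟩, hu⟩, hu'⟩
    exact absurd (hmax hmem) (not_le.2 hr')
  refine ⟨r, v, fun i => ?_, heig⟩
  have h := hAv i
  rw [heig] at h
  exact pos_of_mul_pos_right h hr.1

/-- An eigenvector of a positive matrix for the same eigenvalue as a positive eigenvector is a
multiple of it. -/
theorem Matrix.eq_smul_of_pos_eigenvector [Nonempty I] {A : Matrix I I ℝ}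
    (hA : ∀ i j, 0 < A i j) {r : ℝ} {v w : I → ℝ} (hv : ∀ i, 0 < v i) (hAv : A.mulVec v = r • v)
    (hAw : A.mulVec w = r • w) : ∃ c : ℝ, w = c • v := by
  -- With c the largest ratio, c v - w is non-negative and vanishes at i0. If it were nonzero, A
  -- would make it positive there, yet A only scales it by r.
  obtain ⟨i0, hi0⟩ := Finite.exists_max fun i => w i / v i
  set c := w i0 / v i0 with hc
  refine ⟨c, ?_⟩
  by_contra hne
  have h0 : (0 : I → ℝ) ≤ c • v - w := fun i =>
    sub_nonneg.2 ((div_le_iff₀ (hv i)).1 (hi0 i))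
  have h1 := Matrix.mulVec_pos_of_pos hA h0 (sub_ne_zero.2 (Ne.symm hne)) i0
  rw [Matrix.mulVec_sub, Matrix.mulVec_smul, hAv, hAw] at h1
  have h2 : c * v i0 = w i0 := div_mul_cancel₀ _ (hv i0).ne'
  simp only [Pi.sub_apply, Pi.smul_apply, smul_eq_mul] at h1
  rw [← h2] at h1
  linarith [mul_left_comm c r (v i0)]

/-- An eigenvalue of a non-negative matrix is at most the eigenvalue of a positive eigenvector. -/
theorem Matrix.le_of_pos_eigenvector {A : Matrix I I ℝ} (hA : ∀ i j, 0 ≤ A i j)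
    {f r : ℝ} {d v : I → ℝ} (hd : ∀ i, 0 < d i) (hAd : A.mulVec d = f • d) (hv : v ≠ 0)
    (hAv : A.mulVec v = r • v) : r ≤ f := by
  obtain ⟨j, hj⟩ := Function.ne_iff.1 hv
  have : Nonempty I := ⟨j⟩
  obtain ⟨i, hi⟩ := Finite.exists_max fun i => |v i| / d i
  set t := |v i| / d i with ht
  have hti : t * d i = |v i| := div_mul_cancel₀ _ (hd i).ne'
  have htpos : 0 < t := (div_pos (abs_pos.2 hj) (hd j)).trans_le (hi j)
  have hvi : 0 < |v i| := hti ▸ mul_pos htpos (hd i)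
  have h1 : ∀ l, |v l| ≤ t * d l := fun l => (div_le_iff₀ (hd l)).1 (hi l)
  have h2 : r * v i = ∑ l, A i l * v l := (congrFun hAv i).symm
  have h3 : f * d i = ∑ l, A i l * d l := (congrFun hAd i).symm
  refine le_of_mul_le_mul_right ?_ hvi
  calc r * |v i| ≤ |r| * |v i| := mul_le_mul_of_nonneg_right (le_abs_self r) hvi.le
    _ = |∑ l, A i l * v l| := by rw [← abs_mul, h2]
    _ ≤ ∑ l, |A i l * v l| := Finset.abs_sum_le_sum_abs _ _
    _ ≤ ∑ l, t * (A i l * d l) := Finset.sum_le_sum fun l _ => by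
        rw [abs_mul, abs_of_nonneg (hA i l), mul_left_comm]
        exact mul_le_mul_of_nonneg_left (h1 l) (hA i l)
    _ = f * |v i| := by rw [← Finset.mul_sum, ← h3, ← hti]; ring

/-- The **Schur test** for a non-negative matrix with common positive left and right eigenvector. -/
theorem Matrix.schur_test {A : Matrix I I ℝ} (hA : ∀ i j, 0 ≤ A i j) {f : ℝ} {d : I → ℝ}
    (hd : ∀ i, 0 < d i) (hr : ∀ i, ∑ j, A i j * d j = f * d i)
    (hl : ∀ j, ∑ i, A i j * d i = f * d j) (a c : I → ℝ) :
    ∑ i, ∑ j, a i * A i j * c j ≤ f / 2 * (∑ i, a i ^ 2 + ∑ j, c j ^ 2) := by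
  -- Weighted AM-GM: the difference is a multiple of (a_i d_j - c_j d_i)².
  have h1 : ∀ i j, a i * A i j * c j ≤
      (A i j * d j) * (a i ^ 2 / d i / 2) + (A i j * d i) * (c j ^ 2 / d j / 2) := by
    intro i j
    have hi := hd i
    have hj := hd j
    have : (A i j * d j) * (a i ^ 2 / d i / 2) + (A i j * d i) * (c j ^ 2 / d j / 2)
        - a i * A i j * c j = A i j * ((a i * d j - c j * d i) ^ 2 / (2 * (d i * d j))) := by
      field_simp
      ring
    rw [← sub_nonneg, this]
    exact mul_nonneg (hA i j) (by positivity)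
  have h2 : ∑ i, ∑ j, (A i j * d j) * (a i ^ 2 / d i / 2) = f / 2 * ∑ i, a i ^ 2 := by
    rw [Finset.mul_sum]
    refine Finset.sum_congr rfl fun i _ => ?_
    rw [← Finset.sum_mul, hr]
    have := (hd i).ne'
    field_simp
  have h3 : ∑ i, ∑ j, (A i j * d i) * (c j ^ 2 / d j / 2) = f / 2 * ∑ j, c j ^ 2 := by
    rw [Finset.sum_comm, Finset.mul_sum]
    refine Finset.sum_congr rfl fun j _ => ?_
    rw [← Finset.sum_mul, hl]
    have := (hd j).ne'
    field_simp
  calc _ ≤ ∑ i, ∑ j, ((A i j * d j) * (a i ^ 2 / d i / 2) + (A i j * d i) * (c j ^ 2 / d j / 2)) :=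
        Finset.sum_le_sum fun i _ => Finset.sum_le_sum fun j _ => h1 i j
    _ = _ := by
        simp only [Finset.sum_add_distrib]
        rw [h2, h3, mul_add]

end PerronFrobenius

/-! ### Roots of positive definite bipartite forms -/

section SignDefinite

variable {I : Type*} [Fintype I]

/-- The quadratic form of a bipartite graph with `N i j` edges between `i` and `j`. -/
def bipartiteForm (N : I → I → ℤ) (a c : I → ℤ) : ℤ :=
  ∑ i, a i ^ 2 + ∑ j, c j ^ 2 - ∑ i, ∑ j, a i * N i j * c j

/-- Roots of a positive definite bipartite graph are positive or negative. -/
theorem nonneg_or_nonpos_of_bipartiteForm_eq_one {N : I → I → ℤ} (hN : ∀ i j, 0 ≤ N i j)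
    (hpos : ∀ a c : I → ℤ, a ≠ 0 ∨ c ≠ 0 → 0 < bipartiteForm N a c) {a c : I → ℤ}
    (h : bipartiteForm N a c = 1) : (0 ≤ a ∧ 0 ≤ c) ∨ (a ≤ 0 ∧ c ≤ 0) := by
  -- Splitting a root into positive and negative parts leaves a non-negative cross term. Were both
  -- parts nonzero, each would contribute at least 1 by integrality, exceeding the total 1.
  have key : bipartiteForm N a⁺ c⁺ + bipartiteForm N a⁻ c⁻ +
      ∑ i, ∑ j, N i j * (a⁺ i * c⁻ j + a⁻ i * c⁺ j) = bipartiteForm N a c := by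
    have hsq : ∀ b : I → ℤ, ∑ i, b⁺ i ^ 2 + ∑ i, b⁻ i ^ 2 = ∑ i, b i ^ 2 := fun b => by
      rw [← Finset.sum_add_distrib]
      refine Finset.sum_congr rfl fun i => ?_
      rw [Pi.posPart_apply, Pi.negPart_apply]
      rcases le_total 0 (b i) with hb | hb
      · simp [posPart_of_nonneg hb, negPart_of_nonneg hb]
      · simp [posPart_of_nonpos hb, negPart_of_nonpos hb]
    have hc : ∑ i, ∑ j, a i * N i j * c j = ∑ i, ∑ j, a⁺ i * N i j * c⁺ j +
        ∑ i, ∑ j, a⁻ i * N i j * c⁻ j - ∑ i, ∑ j, N i j * (a⁺ i * c⁻ j + a⁻ i * c⁺ j) := by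
      simp only [← Finset.sum_add_distrib, ← Finset.sum_sub_distrib]
      refine Finset.sum_congr rfl fun i _ => Finset.sum_congr rfl fun j _ => ?_
      have h1 : a i = a⁺ i - a⁻ i := (congrFun (posPart_sub_negPart a) i).symm
      have h2 : c j = c⁺ j - c⁻ j := (congrFun (posPart_sub_negPart c) j).symm
      rw [h1, h2]
      ring
    rw [bipartiteForm, bipartiteForm, bipartiteForm, hc, ← hsq a, ← hsq c]
    ring
  have hcross : 0 ≤ ∑ i, ∑ j, N i j * (a⁺ i * c⁻ j + a⁻ i * c⁺ j) :=
    Finset.sum_nonneg fun i _ => Finset.sum_nonneg fun j _ => mul_nonneg (hN i j)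
      (add_nonneg (mul_nonneg (posPart_nonneg a i) (negPart_nonneg c j))
        (mul_nonneg (negPart_nonneg a i) (posPart_nonneg c j)))
  by_cases h1 : a⁻ ≠ 0 ∨ c⁻ ≠ 0
  · by_cases h2 : a⁺ ≠ 0 ∨ c⁺ ≠ 0
    · have := hpos _ _ h1
      have := hpos _ _ h2
      omega
    · push Not at h2
      exact Or.inr ⟨posPart_eq_zero.1 h2.1, posPart_eq_zero.1 h2.2⟩
  · push Not at h1
    exact Or.inl ⟨negPart_eq_zero.1 h1.1, negPart_eq_zero.1 h1.2⟩

end SignDefinite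

/-! ### Alternating Chebyshev sequences -/

section AlternatingSequence

variable {R : Type*} [Ring R]

/-- The alternating Chebyshev sequence `0, 1, x, y x - 1, x y x - 2 x, …`. -/
def chebAlt (x y : R) : ℕ → R
  | 0 => 0
  | 1 => 1
  | n + 2 => (if Even n then x else y) * chebAlt x y (n + 1) - chebAlt x y n

theorem chebAlt_add_two (x y : R) (n : ℕ) : chebAlt x y (n + 2) =
    (if Even n then x else y) * chebAlt x y (n + 1) - chebAlt x y n := by
  rw [chebAlt]

theorem chebAlt_two_mul_add_two (x y : R) (k : ℕ) :
    chebAlt x y (2 * k + 2) = x * chebAlt x y (2 * k + 1) - chebAlt x y (2 * k) := by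
  rw [chebAlt_add_two, if_pos (even_two_mul k)]

theorem chebAlt_two_mul_add_three (x y : R) (k : ℕ) :
    chebAlt x y (2 * k + 3) = y * chebAlt x y (2 * k + 2) - chebAlt x y (2 * k + 1) := by
  rw [chebAlt_add_two, if_neg (Nat.not_even_two_mul_add_one k)]

/-- The recurrence runs equally well backwards, so a zero at m is a centre of antisymmetry. The
indices m + j and m - j have equal parity, so the same letter, x or y, appears on both sides. -/
theorem chebAlt_add_eq_neg {x y : R} {m : ℕ} (hm : chebAlt x y m = 0) (j : ℕ) :
    ∀ i, i + j = m → chebAlt x y (m + j) = -chebAlt x y i := by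
  induction j using Nat.twoStepInduction with
  | zero =>
    rintro i rfl
    rw [hm, ← add_zero i, hm, neg_zero]
  | one =>
    rintro i rfl
    rw [show i + 1 + 1 = i + 2 from rfl, chebAlt_add_two, hm]
    simp
  | more j h1 h2 =>
    intro i hi
    have e1 := h1 (i + 2) (by omega)
    have e2 := h2 (i + 1) (by omega)
    have hp : Even (m + j) ↔ Even i := by
      subst hi
      simp only [Nat.even_add, even_two]
      tauto
    rw [← add_assoc, chebAlt_add_two, add_assoc, e2, e1, chebAlt_add_two x y i]
    simp only [hp]
    split_ifs <;> noncomm_ring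

theorem chebAlt_two_mul_of_eq_zero {x y : R} {m : ℕ} (hm : chebAlt x y m = 0) :
    chebAlt x y (2 * m) = 0 := by
  rw [two_mul, chebAlt_add_eq_neg hm m 0 (zero_add m), chebAlt, neg_zero]

theorem chebAlt_two_mul_add_one_of_eq_zero {x y : R} {m : ℕ} (hm1 : 1 ≤ m)
    (hm : chebAlt x y m = 0) : chebAlt x y (2 * m + 1) = 1 := by
  obtain ⟨l, rfl⟩ := Nat.exists_eq_add_of_le' hm1
  have h := chebAlt_add_eq_neg hm l 1 (by omega)
  have h2 := chebAlt_two_mul_of_eq_zero hm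
  rw [show 2 * (l + 1) + 1 = 2 * l + 3 by ring, chebAlt_two_mul_add_three,
    show 2 * l + 2 = 2 * (l + 1) by ring, h2, show 2 * l + 1 = l + 1 + l by ring, h, chebAlt]
  simp

theorem map_chebAlt {S : Type*} [Ring S] (d : R →+* S) (x y : R) (n : ℕ) :
    d (chebAlt x y n) = chebAlt (d x) (d y) n := by
  induction n using Nat.twoStepInduction with
  | zero => simp [chebAlt]
  | one => simp [chebAlt]
  | more n h1 h2 =>
    rw [chebAlt_add_two, chebAlt_add_two, map_sub, map_mul, h1, h2]
    split_ifs <;> rfl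

theorem chebAlt_cos_mul_sin (θ : ℝ) (n : ℕ) :
    chebAlt (2 * Real.cos θ) (2 * Real.cos θ) n * Real.sin θ = Real.sin (n * θ) := by
  induction n using Nat.twoStepInduction with
  | zero => simp [chebAlt]
  | one => simp [chebAlt]
  | more n h1 h2 =>
    rw [chebAlt_add_two, ite_self, sub_mul, mul_assoc, h1, h2]
    push_cast
    rw [show ((n : ℝ) + 2) * θ = (n + 1) * θ + θ by ring,
      show (n : ℝ) * θ = (n + 1) * θ - θ by ring, Real.sin_add, Real.sin_sub]
    ring

theorem chebAlt_lt_succ {f : ℝ} (hf : 2 ≤ f) (n : ℕ) :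
    0 ≤ chebAlt f f n ∧ chebAlt f f n < chebAlt f f (n + 1) := by
  induction n with
  | zero => simp [chebAlt]
  | succ n ih =>
    refine ⟨ih.1.trans ih.2.le, ?_⟩
    rw [chebAlt_add_two, ite_self]
    nlinarith [ih.1.trans ih.2.le]

end AlternatingSequence

/-! ### Based rings, their character and the root form -/

namespace Module.Basis

variable {I R : Type*} [Fintype I] [Ring R] (b : Module.Basis I ℤ R)

/-- The bilinear form for which the basis `b` is orthonormal. -/
noncomputable def dotForm (u v : R) : ℤ := ∑ i, b.repr u i * b.repr v i

theorem dotForm_comm (u v : R) : b.dotForm u v = b.dotForm v u := by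
  simp only [dotForm, mul_comm]

theorem dotForm_sub_left (u v w : R) :
    b.dotForm (u - v) w = b.dotForm u w - b.dotForm v w := by
  simp [dotForm, sub_mul, Finset.sum_sub_distrib]

theorem dotForm_sub_right (u v w : R) :
    b.dotForm u (v - w) = b.dotForm u v - b.dotForm u w := by
  simp [dotForm, mul_sub, Finset.sum_sub_distrib]

theorem dotForm_self_basis (i : I) : b.dotForm (b i) (b i) = 1 := by
  classical
  simp [dotForm, Finsupp.single_apply]

theorem dotForm_basis (u : R) (i : I) : b.dotForm u (b i) = b.repr u i := by
  classical
  simp [dotForm, Finsupp.single_apply]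

theorem dotForm_self_pos {u : R} (hu : u ≠ 0) : 0 < b.dotForm u u := by
  have h : b.repr u ≠ 0 := by simpa using hu
  obtain ⟨i, hi⟩ := Finsupp.ne_iff.1 h
  exact Finset.sum_pos' (fun j _ => mul_self_nonneg _)
    ⟨i, Finset.mem_univ _, mul_self_pos.2 hi⟩

/-- `y` is adjoint to `x` if left multiplications by them are adjoint for `dotForm`. -/
def IsAdjoint (x y : R) : Prop := ∀ u v, b.dotForm (x * u) v = b.dotForm u (y * v)

theorem isAdjoint_of_repr {x y : R}
    (h : ∀ i j, b.repr (y * b i) j = b.repr (x * b j) i) : b.IsAdjoint x y := by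
  classical
  have key : ∀ z u i, b.repr (z * u) i = ∑ j, b.repr u j * b.repr (z * b j) i := by
    intro z u i
    conv_lhs => rw [← b.sum_repr u, Finset.mul_sum, map_sum]
    rw [Finsupp.finsetSum_apply]
    refine Finset.sum_congr rfl fun j _ => ?_
    rw [mul_smul_comm, map_zsmul]
    simp
  intro u v
  simp only [dotForm]
  simp_rw [key x u, key y v, Finset.sum_mul, Finset.mul_sum]
  rw [Finset.sum_comm]
  refine Finset.sum_congr rfl fun i _ => Finset.sum_congr rfl fun j _ => ?_
  rw [h j i]
  ring

variable {b}

theorem IsAdjoint.symm {x y : R} (h : b.IsAdjoint x y) : b.IsAdjoint y x := fun u v => by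
  rw [b.dotForm_comm, ← h, b.dotForm_comm]

theorem IsAdjoint.repr_mul_basis {x y : R} (h : b.IsAdjoint x y) (i j : I) :
    b.repr (y * b i) j = b.repr (x * b j) i := by
  rw [← dotForm_basis, ← dotForm_basis, h, dotForm_comm]

variable (b)

/-- The coordinates of `u` are non-negative. -/
def Nonneg (u : R) : Prop := ∀ i, 0 ≤ b.repr u i

omit [Fintype I] in
theorem nonneg_basis (i : I) : b.Nonneg (b i) := fun j => by
  classical
  rw [b.repr_self, Finsupp.single_apply]
  split_ifs <;> simp

/-- A finite-rank ring with a basis containing `1`, non-negative structure constants, and adjoints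
of the left multiplications by the basis elements. -/
structure IsBased (b : Module.Basis I ℤ R) : Prop where
  exists_eq_one : ∃ i, b i = 1
  nonneg_mul : ∀ i j, b.Nonneg (b i * b j)
  exists_adjoint : ∀ i, ∃ y, b.Nonneg y ∧ b.IsAdjoint (b i) y

namespace IsBased

variable {b} (hb : b.IsBased)
include hb

theorem mul_nonneg {u v : R} (hu : b.Nonneg u) (hv : b.Nonneg v) : b.Nonneg (u * v) := by
  intro l
  rw [← b.sum_repr u, ← b.sum_repr v, Finset.sum_mul_sum]
  simp only [map_sum, Finsupp.finsetSum_apply, smul_mul_smul_comm, map_smul, Finsupp.smul_apply,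
    smul_eq_mul]
  exact Finset.sum_nonneg fun i _ => Finset.sum_nonneg fun j _ =>
    _root_.mul_nonneg (_root_.mul_nonneg (hu i) (hv j)) (hb.nonneg_mul i j l)

/-- Let y be the adjoint of b_j. The product b_j y contains 1, so b_j y b_l contains b_l and y b_l ≠
0. By adjointness the required coefficient is the sum of the coordinates of y b_l. -/
theorem mul_sum_basis_pos (j l : I) : 0 < b.repr (b j * ∑ i, b i) l := by
  classical
  obtain ⟨i0, h0⟩ := hb.exists_eq_one
  obtain ⟨y, hy, hadj⟩ := hb.exists_adjoint j
  have hz : b.Nonneg (y * b l) := hb.mul_nonneg hy (b.nonneg_basis l)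
  have h1 : b.repr (b j * ∑ i, b i) l = ∑ i, b.repr (y * b l) i := by
    rw [Finset.mul_sum, map_sum, Finsupp.finsetSum_apply]
    exact Finset.sum_congr rfl fun i _ => hadj.symm.repr_mul_basis i l
  have hy0 : y ≠ 0 := by
    rintro rfl
    have h := hadj 1 (b j)
    rw [mul_one, b.dotForm_self_basis, zero_mul] at h
    simp [dotForm] at h
  have hyy : b.Nonneg (b j * y - 1) := by
    intro i
    rw [map_sub, Finsupp.sub_apply]
    have hn := hb.mul_nonneg (b.nonneg_basis j) hy i
    rw [← h0, b.repr_self, Finsupp.single_apply]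
    split_ifs with h
    · subst h
      have h2 : b.repr (b j * y) i0 = b.dotForm y y := by
        rw [← b.dotForm_basis, hadj, h0, mul_one]
      have := b.dotForm_self_pos hy0
      omega
    · omega
  have h2 := hb.mul_nonneg hyy (b.nonneg_basis l) l
  have hne : y * b l ≠ 0 := fun h => by
    rw [sub_mul, mul_assoc, h, mul_zero, one_mul, zero_sub, map_neg, b.repr_self] at h2
    simp at h2
  rw [h1]
  have h3 : b.repr (y * b l) ≠ 0 := by simpa using hne
  obtain ⟨i, hi⟩ := Finsupp.ne_iff.1 h3
  exact Finset.sum_pos' (fun j _ => hz j) ⟨i, Finset.mem_univ _, (hz i).lt_of_ne' hi⟩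

/-- The **Frobenius-Perron character** of a based ring. -/
theorem exists_character : ∃ d : R →+* ℝ, ∀ i, 0 < d (b i) := by
  classical
  obtain ⟨i0, h0⟩ := hb.exists_eq_one
  have : Nonempty I := ⟨i0⟩
  set ρ : R := ∑ i, b i
  let A : Matrix I I ℝ := Matrix.of fun j l => (b.repr (b j * ρ) l : ℝ)
  have hA : ∀ j l, 0 < A j l := fun j l => Int.cast_pos.2 (hb.mul_sum_basis_pos j l)
  obtain ⟨r, v, hv, hAv⟩ := Matrix.exists_pos_eigenvector hA
  let d : R →ₗ[ℤ] ℝ := b.constr ℤ fun i => v i / v i0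
  have hd : ∀ i, d (b i) = v i / v i0 := fun i => b.constr_basis ℤ _ i
  have hdρ : ∀ u, d (u * ρ) = ∑ l, (b.repr (u * ρ) l : ℝ) * d (b l) := fun u => by
    conv_lhs => rw [← b.sum_repr (u * ρ)]
    rw [map_sum]
    exact Finset.sum_congr rfl fun l _ => (map_zsmul d _ _).trans (zsmul_eq_mul _ _)
  have hdr : ∀ u, d (u * ρ) = r * d u := by
    have : d ∘ₗ LinearMap.mulRight ℤ ρ = (LinearMap.mulLeft ℤ r) ∘ₗ d := by
      refine b.ext fun j => ?_
      have h1 := congrFun hAv j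
      simp only [Matrix.mulVec, dotProduct, Pi.smul_apply, smul_eq_mul] at h1
      simp only [LinearMap.comp_apply, LinearMap.mulRight_apply, LinearMap.mulLeft_apply, hdρ, hd]
      rw [← mul_div_assoc, ← h1, Finset.sum_div]
      exact Finset.sum_congr rfl fun l _ => (mul_div_assoc _ _ _).symm
    exact LinearMap.congr_fun this
  have hd1 : d 1 = 1 := by rw [← h0, hd, div_self (hv i0).ne']
  have hmul : ∀ u w, d (u * w) = d u * d w := by
    intro u w
    -- Left multiplication by u commutes with right multiplication by ρ, so this vector has the same
    -- eigenvalue r. Uniqueness of the eigenvector gives multiplicativity of d.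
    have hw : A.mulVec (fun j => d (u * b j)) = r • fun j => d (u * b j) := by
      ext j
      simp only [Matrix.mulVec, dotProduct, Pi.smul_apply, smul_eq_mul]
      rw [← hdr, mul_assoc]
      conv_rhs => rw [← b.sum_repr (b j * ρ), Finset.mul_sum, map_sum]
      refine Finset.sum_congr rfl fun l _ => ?_
      rw [mul_smul_comm, map_zsmul, zsmul_eq_mul]
      rfl
    obtain ⟨c, hc⟩ := Matrix.eq_smul_of_pos_eigenvector hA hv hAv hw
    have hc' : ∀ j, d (u * b j) = c * v j := congrFun hc
    have hc0 : d u = c * v i0 := by rw [← hc', h0, mul_one]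
    have : d ∘ₗ LinearMap.mulLeft ℤ u = (LinearMap.mulLeft ℤ (d u)) ∘ₗ d := by
      refine b.ext fun j => ?_
      simp only [LinearMap.comp_apply, LinearMap.mulLeft_apply, hd, hc', hc0]
      have := (hv i0).ne'
      field_simp
    exact LinearMap.congr_fun this w
  exact ⟨{ d with map_one' := hd1, map_mul' := hmul, map_zero' := d.map_zero },
    fun i => by
      have : 0 < d (b i) := by rw [hd]; exact div_pos (hv i) (hv i0)
      exact this⟩

end IsBased

section Character

variable {b} {d : R →+* ℝ} (hd : ∀ i, 0 < d (b i))

variable (b) in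
theorem map_eq_sum_repr (d : R →+* ℝ) (u : R) : d u = ∑ i, (b.repr u i : ℝ) * d (b i) := by
  conv_lhs => rw [← b.sum_repr u, map_sum]
  simp

include hd

theorem map_nonneg_of_nonneg {u : R} (hu : b.Nonneg u) : 0 ≤ d u := by
  rw [b.map_eq_sum_repr d u]
  exact Finset.sum_nonneg fun i _ => mul_nonneg (by exact_mod_cast hu i) (hd i).le

theorem eq_zero_of_nonneg_of_map_eq_zero {u : R} (hu : b.Nonneg u) (h : d u = 0) : u = 0 := by
  rw [b.map_eq_sum_repr d u, Finset.sum_eq_zero_iff_of_nonneg fun i _ =>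
    mul_nonneg (by exact_mod_cast hu i) (hd i).le] at h
  refine b.repr.injective ?_
  ext i
  have := (mul_eq_zero.1 (h i (Finset.mem_univ _))).resolve_right (hd i).ne'
  simpa using this

/-- The vector of values d(b_i) is an eigenvector of the matrix and of its transpose. Pairing it
with itself through the matrix equates the eigenvalues. -/
theorem IsAdjoint.map_eq [Nonempty I] {x y : R} (h : b.IsAdjoint x y) : d x = d y := by
  have h1 : ∀ j, ∑ i, (b.repr (x * b i) j : ℝ) * d (b i) = d y * d (b j) := fun j => by
    rw [← map_mul, b.map_eq_sum_repr d (y * b j)]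
    simp only [h.repr_mul_basis]
  have h2 : ∀ i, ∑ j, (b.repr (x * b i) j : ℝ) * d (b j) = d x * d (b i) := fun i => by
    rw [← map_mul, b.map_eq_sum_repr d (x * b i)]
  have h3 : d x * ∑ i, d (b i) ^ 2 = d y * ∑ i, d (b i) ^ 2 := by
    calc d x * ∑ i, d (b i) ^ 2 = ∑ i, (∑ j, (b.repr (x * b i) j : ℝ) * d (b j)) * d (b i) := by
          simp only [h2, Finset.mul_sum]
          exact Finset.sum_congr rfl fun i _ => by ring
      _ = ∑ j, (∑ i, (b.repr (x * b i) j : ℝ) * d (b i)) * d (b j) := by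
          simp only [Finset.sum_mul]
          rw [Finset.sum_comm]
          exact Finset.sum_congr rfl fun j _ => Finset.sum_congr rfl fun i _ => by ring
      _ = d y * ∑ i, d (b i) ^ 2 := by
          simp only [h1, Finset.mul_sum]
          exact Finset.sum_congr rfl fun i _ => by ring
  exact mul_right_cancel₀ (Finset.sum_pos (fun i _ => pow_pos (hd i) 2)
    Finset.univ_nonempty).ne' h3

variable {x y : R} (hadj : b.IsAdjoint x y) (hx : ∀ i, b.Nonneg (x * b i))

include hadj hx in
-- The Schur test bounds the form below by (1 - d(x)/2) times the sum of squares.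
theorem bipartiteForm_pos_of_map_lt_two (hf : d x < 2) {a c : I → ℤ} (h : a ≠ 0 ∨ c ≠ 0) :
    0 < bipartiteForm (fun i j => b.repr (x * b i) j) a c := by
  have : Nonempty I := h.elim (fun h => ⟨(Function.ne_iff.1 h).choose⟩)
    (fun h => ⟨(Function.ne_iff.1 h).choose⟩)
  have hs := Matrix.schur_test (A := fun i j => (b.repr (x * b i) j : ℝ)) (f := d x)
    (d := fun i => d (b i)) (fun i j => by exact_mod_cast hx i j) hd
    (fun i => by rw [← map_mul, b.map_eq_sum_repr d (x * b i)])
    (fun j => by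
      rw [hadj.map_eq hd, ← map_mul, b.map_eq_sum_repr d (y * b j)]
      simp only [hadj.repr_mul_basis])
    (fun i => (a i : ℝ)) (fun i => (c i : ℝ))
  have hn : ∀ e : I → ℤ, e ≠ 0 → (0 : ℝ) < ∑ i, (e i : ℝ) ^ 2 := fun e he => by
    obtain ⟨i, hi⟩ := Function.ne_iff.1 he
    refine Finset.sum_pos' (fun j _ => sq_nonneg _) ⟨i, Finset.mem_univ _, ?_⟩
    have : (e i : ℝ) ≠ 0 := by exact_mod_cast hi
    positivity
  have hn' : ∀ e : I → ℤ, (0 : ℝ) ≤ ∑ i, (e i : ℝ) ^ 2 := fun e =>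
    Finset.sum_nonneg fun _ _ => sq_nonneg _
  have hpos : (0 : ℝ) < ∑ i, (a i : ℝ) ^ 2 + ∑ i, (c i : ℝ) ^ 2 :=
    h.elim (fun h => add_pos_of_pos_of_nonneg (hn a h) (hn' c))
      (fun h => add_pos_of_nonneg_of_pos (hn' a) (hn c h))
  have : (0 : ℝ) < (bipartiteForm (fun i j => b.repr (x * b i) j) a c : ℤ) := by
    unfold bipartiteForm
    push_cast
    nlinarith
  exact_mod_cast this

omit hd in
theorem bipartiteForm_repr (x u w : R) :
    bipartiteForm (fun i j => b.repr (x * b i) j) (b.repr u) (b.repr w) =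
      b.dotForm u u + b.dotForm w w - b.dotForm (x * u) w := by
  have h : b.dotForm (x * u) w = ∑ i, ∑ j, b.repr u i * b.repr (x * b i) j * b.repr w j := by
    conv_lhs => rw [← b.sum_repr u, Finset.mul_sum]
    simp only [dotForm, map_sum, Finsupp.finsetSum_apply, mul_smul_comm, map_smul,
      Finsupp.smul_apply, smul_eq_mul, Finset.sum_mul]
    exact Finset.sum_comm
  rw [h]
  simp only [bipartiteForm, dotForm, sq]

omit hd in
include hadj in
-- Advancing the sequence alternately replaces w by x u - w and u by y w - u. These reflections
-- preserve the form, whose value at the initial pair (1, 0) is 1.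
theorem dotForm_chebAlt {i0 : I} (h0 : b i0 = 1) (k : ℕ) :
    (b.dotForm (chebAlt x y (2 * k + 1)) (chebAlt x y (2 * k + 1)) +
      b.dotForm (chebAlt x y (2 * k)) (chebAlt x y (2 * k)) -
      b.dotForm (x * chebAlt x y (2 * k + 1)) (chebAlt x y (2 * k)) = 1) ∧
    (b.dotForm (chebAlt x y (2 * k + 1)) (chebAlt x y (2 * k + 1)) +
      b.dotForm (chebAlt x y (2 * k + 2)) (chebAlt x y (2 * k + 2)) -
      b.dotForm (x * chebAlt x y (2 * k + 1)) (chebAlt x y (2 * k + 2)) = 1) := by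
  have step1 : ∀ u w : R, b.dotForm u u + b.dotForm (x * u - w) (x * u - w) -
      b.dotForm (x * u) (x * u - w) = b.dotForm u u + b.dotForm w w - b.dotForm (x * u) w := by
    intro u w
    simp only [dotForm_sub_left, dotForm_sub_right]
    rw [b.dotForm_comm w (x * u)]
    ring
  have step2 : ∀ u w : R, b.dotForm (y * w - u) (y * w - u) + b.dotForm w w -
      b.dotForm (x * (y * w - u)) w = b.dotForm u u + b.dotForm w w - b.dotForm (x * u) w := by
    intro u w
    rw [hadj, hadj]
    simp only [dotForm_sub_left, dotForm_sub_right]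
    rw [b.dotForm_comm (y * w) u]
    ring
  induction k with
  | zero =>
    have h1 : b.dotForm (chebAlt x y (2 * 0 + 1)) (chebAlt x y (2 * 0 + 1)) +
      b.dotForm (chebAlt x y (2 * 0)) (chebAlt x y (2 * 0)) -
      b.dotForm (x * chebAlt x y (2 * 0 + 1)) (chebAlt x y (2 * 0)) = 1 := by
      have h11 : b.dotForm 1 1 = 1 := by rw [← h0, b.dotForm_self_basis]
      simp only [chebAlt]
      rw [h11]
      simp [dotForm]
    exact ⟨h1, by rw [chebAlt_two_mul_add_two, step1, h1]⟩
  | succ k ih =>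
    have h1 : b.dotForm (chebAlt x y (2 * k + 3)) (chebAlt x y (2 * k + 3)) +
      b.dotForm (chebAlt x y (2 * k + 2)) (chebAlt x y (2 * k + 2)) -
      b.dotForm (x * chebAlt x y (2 * k + 3)) (chebAlt x y (2 * k + 2)) = 1 := by
      rw [chebAlt_two_mul_add_three, step2, ih.2]
    rw [show 2 * (k + 1) = 2 * k + 2 by ring, show 2 * k + 2 + 1 = 2 * k + 3 by ring]
    refine ⟨h1, ?_⟩
    have := chebAlt_two_mul_add_two x y (k + 1)
    rw [show 2 * (k + 1) = 2 * k + 2 by ring, show 2 * k + 2 + 1 = 2 * k + 3 by ring] at this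
    rw [this, step1, h1]

include hadj hx in
theorem chebAlt_nonneg_or_nonpos (hf : d x < 2) {i0 : I} (h0 : b i0 = 1) (n : ℕ) :
    (b.Nonneg (chebAlt x y n) ∧ b.Nonneg (chebAlt x y (n + 1))) ∨
    (b.Nonneg (-chebAlt x y n) ∧ b.Nonneg (-chebAlt x y (n + 1))) := by
  have key : ∀ u w : R, b.dotForm u u + b.dotForm w w - b.dotForm (x * u) w = 1 →
      (b.Nonneg u ∧ b.Nonneg w) ∨ (b.Nonneg (-u) ∧ b.Nonneg (-w)) := by
    intro u w h
    rw [← bipartiteForm_repr] at h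
    refine (nonneg_or_nonpos_of_bipartiteForm_eq_one hx
      (fun a c => bipartiteForm_pos_of_map_lt_two hd hadj hx hf) h).imp id fun h => ?_
    exact ⟨fun i => by simpa using h.1 i, fun i => by simpa using h.2 i⟩
  obtain ⟨k, rfl | rfl⟩ := Nat.even_or_odd' n
  · exact (key _ _ (dotForm_chebAlt hadj h0 k).1).imp And.symm And.symm
  · exact key _ _ (dotForm_chebAlt hadj h0 k).2

include hadj hx in
-- The positive dimension of the m-th term selects the non-negative sign for the pair, and a
-- non-negative class of non-positive dimension is zero.
theorem chebAlt_eq_zero (hf : d x < 2) {i0 : I} (h0 : b i0 = 1) {m : ℕ}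
    (h1 : 0 < d (chebAlt x y m)) (h2 : d (chebAlt x y (m + 1)) ≤ 0) :
    chebAlt x y (m + 1) = 0 := by
  rcases chebAlt_nonneg_or_nonpos hd hadj hx hf h0 m with h | h
  · exact eq_zero_of_nonneg_of_map_eq_zero hd h.2 (h2.antisymm (map_nonneg_of_nonneg hd h.2))
  · have := map_nonneg_of_nonneg hd h.1
    rw [map_neg] at this
    linarith

end Character

end Module.Basis

/-! ### Order of the product of two reflections -/

section RankTwoMatrices

variable {R : Type*} [Ring R] {A B : Matrix.GeneralLinearGroup (Fin 2) R} {x y : R}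
  (hA : A.val = !![-1, y; 0, 1]) (hB : B.val = !![1, 0; x, -1])
include hA hB

theorem rankTwo_pow_fst (k : ℕ) : ((A * B) ^ k).val 0 0 = chebAlt x y (2 * k + 1) ∧
    ((A * B) ^ k).val 1 0 = chebAlt x y (2 * k) := by
  induction k with
  | zero => simp [chebAlt]
  | succ k ih =>
    rw [show 2 * (k + 1) + 1 = 2 * k + 3 by ring, show 2 * (k + 1) = 2 * k + 2 by ring,
      chebAlt_two_mul_add_three, chebAlt_two_mul_add_two, pow_succ', Units.val_mul, Units.val_mul,
      hA, hB]
    simp only [Matrix.mul_apply, Fin.sum_univ_two, ih.1, ih.2]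
    constructor
    · simp
      noncomm_ring
    · simp
      noncomm_ring

theorem rankTwo_pow_snd (k : ℕ) : ((B * A) ^ k).val 1 1 = chebAlt y x (2 * k + 1) ∧
    ((B * A) ^ k).val 0 1 = chebAlt y x (2 * k) := by
  induction k with
  | zero => simp [chebAlt]
  | succ k ih =>
    rw [show 2 * (k + 1) + 1 = 2 * k + 3 by ring, show 2 * (k + 1) = 2 * k + 2 by ring,
      chebAlt_two_mul_add_three, chebAlt_two_mul_add_two, pow_succ', Units.val_mul, Units.val_mul,
      hA, hB]
    simp only [Matrix.mul_apply, Fin.sum_univ_two, ih.1, ih.2]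
    constructor
    · simp
      noncomm_ring
    · simp
      noncomm_ring

/-- The sequence for (x, y) controls only the first column of (AB)^m. The second comes from the
inverse (BA)^m, whose second column is governed by (y, x). -/
theorem rankTwo_pow_eq_one {m : ℕ} (hm : 1 ≤ m) (h1 : chebAlt x y m = 0)
    (h2 : chebAlt y x m = 0) : (A * B) ^ m = 1 := by
  have hAA : A * A = 1 := Units.ext (by
    rw [Units.val_mul, hA, Units.val_one]
    ext i j
    fin_cases i <;> fin_cases j <;> simp)
  have hBB : B * B = 1 := Units.ext (by
    rw [Units.val_mul, hB, Units.val_one]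
    ext i j
    fin_cases i <;> fin_cases j <;> simp)
  have hinv : (B * A) ^ m * (A * B) ^ m = 1 := by
    have : B * A = (A * B)⁻¹ := by
      rw [mul_inv_rev, inv_eq_of_mul_eq_one_left hAA, inv_eq_of_mul_eq_one_left hBB]
    rw [this, inv_pow, inv_mul_cancel]
  obtain ⟨a1, a2⟩ := rankTwo_pow_fst hA hB m
  obtain ⟨b1, b2⟩ := rankTwo_pow_snd hA hB m
  rw [chebAlt_two_mul_of_eq_zero h1] at a2
  rw [chebAlt_two_mul_add_one_of_eq_zero hm h1] at a1
  rw [chebAlt_two_mul_of_eq_zero h2] at b2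
  rw [chebAlt_two_mul_add_one_of_eq_zero hm h2] at b1
  have hval : ((B * A) ^ m).val * ((A * B) ^ m).val = 1 := by
    rw [← Units.val_mul, hinv, Units.val_one]
  set M := ((A * B) ^ m).val with hM
  set N := ((B * A) ^ m).val
  have e00 := congrFun (congrFun hval 0) 0
  have e01 := congrFun (congrFun hval 0) 1
  have e10 := congrFun (congrFun hval 1) 0
  have e11 := congrFun (congrFun hval 1) 1
  simp only [Matrix.mul_apply, Fin.sum_univ_two, a1, a2, b1, b2] at e00 e01 e10 e11
  simp at e00 e01 e10 e11
  simp only [e00, e10] at e01 e11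
  simp at e01 e11
  refine Units.ext ?_
  rw [← hM, Units.val_one]
  ext i j
  fin_cases i <;> fin_cases j <;> simp [a1, a2, e01, e11]

variable {I : Type*} [Fintype I] {b : Module.Basis I ℤ R} {d : R →+* ℝ}

theorem rankTwo_orderOf_eq_zero (hx : 2 ≤ d x) (hxy : d x = d y) : orderOf (A * B) = 0 := by
  rw [orderOf_eq_zero_iff']
  intro k hk h
  have h1 := (rankTwo_pow_fst hA hB k).2
  rw [h] at h1
  have h2 := congrArg d h1
  rw [map_chebAlt, ← hxy] at h2
  simp only [Units.val_one, Matrix.one_apply_ne (by decide : (1 : Fin 2) ≠ 0), map_zero] at h2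
  have hpos : 0 < chebAlt (d x) (d x) (2 * k) := by
    obtain ⟨l, hl⟩ := Nat.exists_eq_add_of_le' (show 1 ≤ 2 * k by omega)
    rw [hl]
    exact (chebAlt_lt_succ hx l).1.trans_lt (chebAlt_lt_succ hx l).2
  exact hpos.ne h2

theorem rankTwo_exists_orderOf_eq (hd : ∀ i, 0 < d (b i)) {i0 : I} (h0 : b i0 = 1)
    (hadj : b.IsAdjoint x y) (hx : ∀ i, b.Nonneg (x * b i)) (hf0 : 0 ≤ d x) (hf : d x < 2) :
    ∃ m : ℕ, 1 ≤ m ∧ orderOf (A * B) = m ∧ d x = 2 * Real.cos (Real.pi / m) := by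
  have : Nonempty I := ⟨i0⟩
  have hxy : d x = d y := hadj.map_eq hd
  have hy : ∀ i, b.Nonneg (y * b i) := fun i j => by
    rw [hadj.repr_mul_basis]
    exact hx j i
  obtain ⟨θ, hθ⟩ : ∃ θ, θ = Real.arccos (d x / 2) := ⟨_, rfl⟩
  have hcos : d x = 2 * Real.cos θ := by
    rw [hθ, Real.cos_arccos (by linarith) (by linarith)]
    ring
  have hθ0 : 0 < θ := hθ ▸ Real.arccos_pos.2 (by linarith)
  have hθ2 : θ ≤ Real.pi / 2 := hθ ▸ Real.arccos_le_pi_div_two.2 (by linarith)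
  have hπ := Real.pi_pos
  have hsin : 0 < Real.sin θ := Real.sin_pos_of_pos_of_lt_pi hθ0 (by linarith)
  have hcheb : ∀ n, d (chebAlt x y n) * Real.sin θ = Real.sin (n * θ) := fun n => by
    rw [map_chebAlt, ← hxy, hcos, chebAlt_cos_mul_sin]
  have hcheb' : ∀ n, d (chebAlt y x n) * Real.sin θ = Real.sin (n * θ) := fun n => by
    rw [map_chebAlt, ← hxy, hcos, chebAlt_cos_mul_sin]
  -- The index l + 1 is the first positive n with nθ ≥ π, where sin(nθ) first fails to be positive.
  obtain ⟨l, hl⟩ : ∃ l, ⌈Real.pi / θ⌉₊ = l + 1 :=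
    Nat.exists_eq_add_of_le' (Nat.ceil_pos.2 (div_pos hπ hθ0))
  have hl1 : (l : ℝ) * θ < Real.pi := by
    rw [← lt_div_iff₀ hθ0]
    exact Nat.lt_ceil.1 (by omega)
  have hl2 : Real.pi ≤ ((l + 1 : ℕ) : ℝ) * θ := by
    rw [← div_le_iff₀ hθ0, ← hl]
    exact Nat.le_ceil _
  -- Uses θ ≤ π/2, that is d(x) ≥ 0, which excludes l = 0.
  have hl3 : 0 < (l : ℝ) * θ := by
    push_cast at hl2
    linarith
  have hs1 : 0 < Real.sin (l * θ) := Real.sin_pos_of_pos_of_lt_pi hl3 hl1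
  have hs2 : Real.sin ((l + 1 : ℕ) * θ) ≤ 0 := by
    rw [← neg_nonneg, ← Real.sin_sub_pi]
    refine Real.sin_nonneg_of_nonneg_of_le_pi (by linarith) ?_
    push_cast
    linarith
  have hz : chebAlt x y (l + 1) = 0 := by
    refine Module.Basis.chebAlt_eq_zero hd hadj hx hf h0 ?_ ?_
    · exact pos_of_mul_pos_left ((hcheb l).symm ▸ hs1) hsin.le
    · exact nonpos_of_mul_nonpos_left ((hcheb (l + 1)).symm ▸ hs2) hsin
  have hz' : chebAlt y x (l + 1) = 0 := by
    refine Module.Basis.chebAlt_eq_zero hd hadj.symm hy (hxy ▸ hf) h0 ?_ ?_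
    · exact pos_of_mul_pos_left ((hcheb' l).symm ▸ hs1) hsin.le
    · exact nonpos_of_mul_nonpos_left ((hcheb' (l + 1)).symm ▸ hs2) hsin
  have hsin0 : Real.sin ((l + 1 : ℕ) * θ) = 0 := by rw [← hcheb, hz, map_zero, zero_mul]
  have hπeq : ((l + 1 : ℕ) : ℝ) * θ = Real.pi := by
    rw [← neg_eq_zero, ← Real.sin_sub_pi, Real.sin_eq_zero_iff_of_lt_of_lt (by linarith)
      (by push_cast; linarith)] at hsin0
    linarith
  have hm0 : ((l + 1 : ℕ) : ℝ) ≠ 0 := Nat.cast_ne_zero.2 (Nat.succ_ne_zero l)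
  have hθm : θ = Real.pi / (l + 1 : ℕ) := by rw [← hπeq, mul_div_cancel_left₀ _ hm0]
  refine ⟨l + 1, by omega, Nat.dvd_antisymm (orderOf_dvd_of_pow_eq_one
    (rankTwo_pow_eq_one hA hB (by omega) hz hz')) ?_, by rw [← hθm, hcos]⟩
  -- Conversely, the identity gives d(c_{2k}) = 0 and d(c_{2k+1}) = 1, so cos(2kθ) = 1 and kθ is a
  -- multiple of π = (l + 1)θ.
  set k := orderOf (A * B) with hk
  obtain ⟨h1, h2⟩ := rankTwo_pow_fst hA hB k
  rw [hk, pow_orderOf_eq_one, ← hk] at h1 h2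
  simp only [Units.val_one, Matrix.one_apply_eq,
    Matrix.one_apply_ne (by decide : (1 : Fin 2) ≠ 0)] at h1 h2
  have e1 := hcheb (2 * k + 1)
  have e2 := hcheb (2 * k)
  rw [← h1, map_one, one_mul] at e1
  rw [← h2, map_zero, zero_mul] at e2
  push_cast at e1 e2
  rw [add_mul, one_mul, Real.sin_add, ← e2, zero_mul, zero_add] at e1
  have hc : Real.cos (2 * k * θ) = 1 := mul_right_cancel₀ hsin.ne' (by rw [one_mul, ← e1])
  obtain ⟨n, hn⟩ := (Real.cos_eq_one_iff _).1 hc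
  have hn' : (n : ℝ) * ((l + 1 : ℕ) : ℝ) = k := by
    refine mul_right_cancel₀ hθ0.ne' ?_
    rw [mul_assoc, hπeq]
    linarith
  have : ((k : ℕ) : ℤ) = ((l + 1 : ℕ) : ℤ) * n := by
    have : ((k : ℤ) : ℝ) = (((l + 1 : ℕ) : ℤ) * n : ℤ) := by
      push_cast
      push_cast at hn'
      linarith
    exact_mod_cast this
  exact Int.natCast_dvd_natCast.1 ⟨n, this⟩

end RankTwoMatrices

/-! ### Application to fusion categories -/

namespace FusionCategory

variable (k : Type*) [Field k] [IsAlgClosed k] {C : Type*} [Category C] [Abelian C]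
    [Linear k C] [MonoidalCategory C] [MonoidalPreadditive C] [MonoidalLinear k C] [RigidCategory C]
    [FusionCategory k C] [inst : Fintype (Irr C)]

omit [IsAlgClosed k] inst in
theorem K0.coeff_of_nonneg (i : Irr C) (X : C) : 0 ≤ K0.coeff k i (K0.of X) := by
  rw [K0.coeff_of]
  exact Int.natCast_nonneg _

theorem K0.isAdjoint_lDual (X : C) : (K0.basis k).IsAdjoint (K0.of X) (K0.of (lDual X)) :=
  (K0.basis k).isAdjoint_of_repr (K0.repr_lDual_mul k X)

theorem K0.basis_eq_one : ∃ i, K0.basis k i = (1 : K0 C) := by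
  have : Simple (𝟙_ C) := FusionCategory.simple_unit (k := k)
  obtain ⟨i, ⟨e⟩⟩ := Irr.exists_iso (𝟙_ C)
  exact ⟨i, (K0.basis_apply k i).trans (K0.of_iso e).symm⟩

theorem K0.nonneg_of_mul_basis (X : C) (i : Irr C) :
    (K0.basis k).Nonneg (K0.of X * K0.basis k i) := fun j => by
  rw [K0.basis_apply, K0.of_mul_of]
  exact K0.coeff_of_nonneg k j _

/-- The Grothendieck ring of a fusion category is a based ring. -/
theorem K0.isBased : (K0.basis k : Module.Basis (Irr C) ℤ (K0 C)).IsBased where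
  exists_eq_one := K0.basis_eq_one k
  nonneg_mul i j := by
    rw [K0.basis_apply k i]
    exact K0.nonneg_of_mul_basis k _ j
  exists_adjoint i := ⟨K0.of (lDual i.rep), fun j => K0.coeff_of_nonneg k j _, by
    rw [K0.basis_apply]
    exact K0.isAdjoint_lDual k _⟩

/-- A ring homomorphism `[C] → ℝ` that is positive on simple objects computes `FPdim`. -/
theorem FPdim_eq_character {d : K0 C →+* ℝ} (hd : ∀ i, 0 < d (K0.basis k i)) (X : C) :
    FPdim k X = d (K0.of X) := by
  -- `FPdim` carries its own `Fintype` instance, which must match the ambient one.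
  obtain rfl : inst = @Fintype.ofFinite _ (finite_irr k) := Subsingleton.elim _ _
  let _ : Fintype (Irr C) := @Fintype.ofFinite _ (finite_irr k)
  obtain ⟨i0, -⟩ := K0.basis_eq_one (C := C) k
  have hX : 0 ≤ d (K0.of X) :=
    Module.Basis.map_nonneg_of_nonneg hd fun i => K0.coeff_of_nonneg k i X
  have heig : (fusionMatrix k X).mulVec (fun i => d (K0.basis k i)) =
      d (K0.of X) • fun i => d (K0.basis k i) := by
    ext i
    simp only [Matrix.mulVec, dotProduct, fusionMatrix_apply, Pi.smul_apply, smul_eq_mul]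
    rw [← map_mul, (K0.basis k).map_eq_sum_repr d (K0.of X * _)]
  refine IsGreatest.csSup_eq ⟨⟨hX, ?_⟩, fun r hr => ?_⟩
  · refine Module.End.hasEigenvalue_of_hasEigenvector
      (x := fun i => d (K0.basis k i)) ⟨Module.End.mem_eigenspace_iff.2 heig, fun h => ?_⟩
    exact (hd i0).ne' (congrFun h i0)
  · obtain ⟨v, hv⟩ := hr.2.exists_hasEigenvector
    exact Matrix.le_of_pos_eigenvector
      (fun i j => by rw [fusionMatrix, Matrix.of_apply]; positivity) hd heig hv.2
      (Module.End.mem_eigenspace_iff.1 hv.1)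

end FusionCategory

theorem FusionQuiver.sigmaA_eq_reflection (k : Type*) [Field k] [IsAlgClosed k] {C : Type*}
    [Category C] [Abelian C] [Linear k C] [MonoidalCategory C] [MonoidalPreadditive C]
    [MonoidalLinear k C] [RigidCategory C] [FusionCategory k C] (P : C) :
    FusionQuiver.sigmaA P = (FusionQuiver.rankTwo P).reflection 0 := by
  let _ : Fintype (Irr C) := @Fintype.ofFinite _ (finite_irr k)
  refine Units.ext ?_
  rw [FusionQuiver.sigmaA_val, K0.of_lDual_eq_of_rDual k P]
  have h0 : ((FusionQuiver.rankTwo P).reflection 0).val =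
    1 - (FusionQuiver.rankTwo P).formRow 0 := rfl
  rw [h0]
  ext i j
  fin_cases i <;> fin_cases j <;>
    simp [FusionQuiver.formRow, FusionQuiver.form, FusionQuiver.rankTwo]
  norm_num

theorem mainTheorem8 {k : Type*} [Field k] [IsAlgClosed k] {C : Type*} [Category C] [Abelian C]
    [Linear k C] [MonoidalCategory C] [MonoidalPreadditive C] [MonoidalLinear k C] [RigidCategory C]
    [FusionCategory k C] (P : C) :
    FusionQuiver.sigmaA P * FusionQuiver.sigmaB P ∈ (FusionQuiver.rankTwo P).reflectionGroup ∧
    (IsOfFinOrder (FusionQuiver.sigmaA P * FusionQuiver.sigmaB P) ↔ FPdim k P < 2) ∧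
    ∀ m : ℕ, 1 ≤ m → (orderOf (FusionQuiver.sigmaA P * FusionQuiver.sigmaB P) = m ↔
      FPdim k P = 2 * Real.cos (Real.pi / m)) := by
  let _ : Fintype (Irr C) := @Fintype.ofFinite _ (finite_irr k)
  obtain ⟨d, hd⟩ := (K0.isBased (C := C) k).exists_character
  obtain ⟨i0, h0⟩ := K0.basis_eq_one (C := C) k
  have : Nonempty (Irr C) := ⟨i0⟩
  have hadj := K0.isAdjoint_lDual k P
  have hA := FusionQuiver.sigmaA_val P
  have hB := FusionQuiver.sigmaB_val P
  rw [FPdim_eq_character k hd P]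
  have hlt : d (K0.of P) < 2 → ∃ m : ℕ, 1 ≤ m ∧
      orderOf (FusionQuiver.sigmaA P * FusionQuiver.sigmaB P) = m ∧
      d (K0.of P) = 2 * Real.cos (Real.pi / m) :=
    rankTwo_exists_orderOf_eq hA hB hd h0 hadj (K0.nonneg_of_mul_basis k P)
      (Module.Basis.map_nonneg_of_nonneg hd fun i => K0.coeff_of_nonneg k i P)
  have hge : 2 ≤ d (K0.of P) → orderOf (FusionQuiver.sigmaA P * FusionQuiver.sigmaB P) = 0 :=
    fun h => rankTwo_orderOf_eq_zero hA hB h (hadj.map_eq hd)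
  have hmem : ∀ m : ℕ, 1 ≤ m → Real.pi / m ∈ Set.Icc 0 Real.pi := fun m hm =>
    ⟨by positivity, div_le_self Real.pi_pos.le (by exact_mod_cast hm)⟩
  refine ⟨?_, ?_, fun m hm => ?_⟩
  · rw [FusionQuiver.sigmaA_eq_reflection k P]
    exact mul_mem (Subgroup.subset_closure ⟨0, rfl⟩) (Subgroup.subset_closure ⟨1, rfl⟩)
  · rw [← orderOf_pos_iff]
    constructor
    · intro h
      by_contra! h2
      rw [hge h2] at h
      exact h.false
    · intro h
      obtain ⟨m, hm, hord, -⟩ := hlt h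
      omega
  · rcases lt_or_ge (d (K0.of P)) 2 with h | h
    · obtain ⟨n, hn, hord, hcos⟩ := hlt h
      rw [hord, hcos]
      refine ⟨fun e => by rw [e], fun e => ?_⟩
      -- Injectivity of cosine on [0, π] makes m unique.
      have e' := Real.injOn_cos (hmem n hn) (hmem m hm) (mul_left_cancel₀ two_ne_zero e)
      have hn0 : (n : ℝ) ≠ 0 := by positivity
      have hm0 : (m : ℝ) ≠ 0 := by positivity
      rw [div_eq_div_iff hn0 hm0] at e'
      exact_mod_cast (mul_left_cancel₀ Real.pi_ne_zero e').symm
    · rw [hge h]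
      refine ⟨fun e => by omega, fun e => ?_⟩
      have hm0 : (0 : ℝ) < m := by exact_mod_cast hm
      have := Real.cos_lt_cos_of_nonneg_of_le_pi le_rfl (hmem m hm).2 (div_pos Real.pi_pos hm0)
      rw [Real.cos_zero] at this
      linarith
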